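/- Let $0<\beta<\infty$, $0\le\lambda<\infty$, and let $\mathbf h:[0,\beta]\to\mathbb R$ be Lebesgue measurable with $\|\mathbf h\|_\infty<\infty$ (essential supremum). Let $\Sigma$ be the set of càdlàg functions $\sigma:[0,\beta]\to\{-1,+1\}$, with the $\sigma$-algebra generated by the events $\{\sigma(t)=+1\}$, $t\in[0,\beta]$. Let $\varphi$ be the law on $\Sigma$ of the random spin that, given a Poisson point process of intensity $\lambda$ on $[0,\beta]$, is with equal probability one of the two elements of $\Sigma$ that flip exactly at the points of the process. Write $\mathbf h\bullet\sigma=\int_0^\beta \mathbf h(t)\,\sigma(t)\,\mathrm dt$, and define the probability measures $$\mu^{\emptyset}(\mathrm d\sigma)=\frac{1}{Z}\,e^{\mathbf h\bullet\sigma}\,\varphi(\mathrm d\sigma),\qquad \mu^{\mathrm{per}}(\mathrm d\sigma)=\frac{\mathbf 1_{\{\sigma(0)=\sigma(\beta)\}}}{Z^{\mathrm{per}}}\,e^{\mathbf h\bullet\sigma}\,\varphi(\mathrm d\sigma),$$ where $Z$ and $Z^{\mathrm{per}}$ are the normalizing constants. Call $f:\Sigma\to\mathbb R$ increasing if $f(\sigma)\le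 f(\sigma')$ whenever $\sigma(t)\le\sigma'(t)$ for almost every $t\in[0,\beta]$. Then for each $\pi\in\{\emptyset,\mathrm{per}\}$ and all measurable increasing $f,g:\Sigma\to\mathbb R$, $$\mu^{\pi}(fg)\ \ge\ \mu^{\pi}(f)\,\mu^{\pi}(g).$$ -/

import Mathlib

open MeasureTheory Filter Topology Set

noncomputable section

/-- The time interval `[0, β]`, with the topology, order and `σ`-algebra inherited from `ℝ`. -/
abbrev TimeInterval (β : ℝ) : Type := Set.Icc (0 : ℝ) β

/-- Lebesgue measure on `[0, β]`. -/
def timeMeasure (β : ℝ) : Measure (TimeInterval β) := Measure.comap Subtype.val volume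

/-- `σ : [0, β] → ℝ` is càdlàg (right continuous with left limits) with values in `{1, -1}`. -/
structure IsSpinPath {β : ℝ} (σ : TimeInterval β → ℝ) : Prop where
  values : ∀ t, σ t = 1 ∨ σ t = -1
  right_continuous : ∀ t, ContinuousWithinAt σ (Set.Ici t) t
  left_limit : ∀ t, ∃ l, Tendsto σ (𝓝[<] t) (𝓝 l)

/-- The set of single spins on `[0, β]`. As a subtype of a product it carries the `σ`-algebra
generated by the evaluations `σ ↦ σ t`, i.e. by the events `{σ t = 1}`. -/
abbrev SpinPath (β : ℝ) : Type := {σ : TimeInterval β → ℝ // IsSpinPath σ}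

/-- The number of points of `x` in `[0, t]`. -/
def pointCount {β : ℝ} {n : ℕ} (x : Fin n → TimeInterval β) (t : TimeInterval β) : ℕ :=
  (Finset.univ.filter fun i => x i ≤ t).card

theorem pointCount_right {β : ℝ} {n : ℕ} (x : Fin n → TimeInterval β) (t : TimeInterval β) :
    ∀ᶠ u in 𝓝[≥] t, pointCount x u = pointCount x t := by
  have h : ∀ i, ∀ᶠ u in 𝓝[≥] t, (x i ≤ u ↔ x i ≤ t) := by
    intro i
    by_cases hi : x i ≤ t
    · filter_upwards [self_mem_nhdsWithin] with u hu
      exact ⟨fun _ => hi, fun _ => hi.trans hu⟩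
    · have : Set.Iio (x i) ∈ 𝓝[≥] t := mem_nhdsWithin_of_mem_nhds (Iio_mem_nhds (not_le.1 hi))
      filter_upwards [this] with u hu
      exact ⟨fun h => absurd h (not_le.2 hu), fun h => absurd h hi⟩
  filter_upwards [eventually_all.2 h] with u hu
  simp only [pointCount, hu]

theorem pointCount_left {β : ℝ} {n : ℕ} (x : Fin n → TimeInterval β) (t : TimeInterval β) :
    ∃ k : ℕ, ∀ᶠ u in 𝓝[<] t, pointCount x u = k := by
  refine ⟨(Finset.univ.filter fun i => x i < t).card, ?_⟩
  have h : ∀ i, ∀ᶠ u in 𝓝[<] t, (x i ≤ u ↔ x i < t) := by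
    intro i
    by_cases hi : x i < t
    · have : Set.Ioi (x i) ∈ 𝓝[<] t := mem_nhdsWithin_of_mem_nhds (Ioi_mem_nhds hi)
      filter_upwards [this] with u hu
      exact ⟨fun _ => hi, fun _ => le_of_lt hu⟩
    · filter_upwards [self_mem_nhdsWithin] with u hu
      exact ⟨fun h => lt_of_le_of_lt h hu, fun h => absurd h hi⟩
  filter_upwards [eventually_all.2 h] with u hu
  simp only [pointCount, hu]

/-- The spin `t ↦ s (-1) ^ #{i | x i ≤ t}`. When the points `x i` are distinct and
positive, this is the spin with `σ 0 = s` whose flips are exactly the points `x i`. -/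
def flipPath {β : ℝ} (s : ℤˣ) (x : Σ n : ℕ, Fin n → TimeInterval β) : SpinPath β :=
  ⟨fun t => (((s * (-1) ^ pointCount x.2 t : ℤˣ) : ℤ) : ℝ), by
    refine ⟨fun t => ?_, fun t => ?_, fun t => ?_⟩
    · rcases Int.units_eq_one_or (s * (-1) ^ pointCount x.2 t) with h | h <;> rw [h] <;> simp
    · refine tendsto_const_nhds.congr' ?_
      filter_upwards [pointCount_right x.2 t] with u hu
      rw [hu]
    · obtain ⟨k, hk⟩ := pointCount_left x.2 t
      refine ⟨(((s * (-1) ^ k : ℤˣ) : ℤ) : ℝ), tendsto_const_nhds.congr' ?_⟩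
      filter_upwards [hk] with u hu
      rw [hu]⟩

/-- The Poisson point process on `[0, β]` with intensity `lam`, as a law on finite families of
points: with `Λ = lam · Lebesgue` (total mass `lam β`), it is
`∑ₙ exp (-(lam β)) / n! · Λ^{⊗ n}`, that is, a `Poisson(lam β)` number of independent points which
are uniform on `[0, β]`. -/
def poissonPoints (β lam : ℝ) : Measure (Σ n : ℕ, Fin n → TimeInterval β) :=
  Measure.sum fun n : ℕ =>
    ENNReal.ofReal (Real.exp (-(lam * β)) / (n.factorial : ℝ)) •
      (Measure.pi fun _ : Fin n =>
        ENNReal.ofReal lam • timeMeasure β).map (Sigma.mk n)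

/-- The law `φ` of the free spin: with equal probability one of the two spins that flip exactly
at the points of the Poisson process of intensity `lam`. -/
def freeSpin (β lam : ℝ) : Measure (SpinPath β) :=
  ∑ s : ℤˣ, (2⁻¹ : ENNReal) • (poissonPoints β lam).map (flipPath s)

/-- The product `h • σ = ∫_[0, β] h t σ t dt`. -/
def fieldDot {β : ℝ} (h : TimeInterval β → ℝ) (σ : SpinPath β) : ℝ :=
  ∫ t, h t * σ.1 t ∂(timeMeasure β)

/-- The two imaginary time boundary conditions: none, or `σ 0 = σ β`. -/
inductive TimeBC where
  | free
  | periodic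

/-- The event `{σ 0 = σ β}`. -/
def periodicEvent {β : ℝ} (hβ : 0 < β) : Set (SpinPath β) :=
  {σ | σ.1 ⟨0, left_mem_Icc.2 hβ.le⟩ = σ.1 ⟨β, right_mem_Icc.2 hβ.le⟩}

/-- The single-site measures `Z⁻¹ exp (h • σ) φ(dσ)` (free) and
`(Z^per)⁻¹ 1_{σ 0 = σ β} exp (h • σ) φ(dσ)` (periodic). -/
def spinMeasure {β : ℝ} (hβ : 0 < β) (h : TimeInterval β → ℝ) (lam : ℝ) :
    TimeBC → Measure (SpinPath β)
  | .free => (freeSpin β lam).tilted (fieldDot h)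
  | .periodic => ((freeSpin β lam).restrict (periodicEvent hβ)).tilted (fieldDot h)

/-- `f` is increasing: `σ t ≤ σ' t` for almost every `t ∈ [0, β]` implies `f σ ≤ f σ'`. -/
def SpinIncreasing {β : ℝ} (f : SpinPath β → ℝ) : Prop :=
  ∀ σ σ' : SpinPath β, (∀ᵐ t ∂(timeMeasure β), σ.1 t ≤ σ'.1 t) → f σ ≤ f σ'

end

/-! The Poisson process is the limit of a sparse thinning: drop `M` independent uniform points on
`[0, β]` and keep each with probability `p = lam * β / M`. With the points frozen and sorted, the
spin is read off a two-state Markov chain of `M + 1` signs. For `p ≤ 1 / 2` its path weight is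
log-supermodular, so the finite `fkg` inequality on the lattice of sign sequences applies for each
choice of points (`quenchedMean_fkg`). The field weight preserves this, since its exponent is linear
in `σ`, and so does the periodic indicator, since its event is closed under min and max.

Averaging over the points is the delicate step: it gives the mean of a product of two quenched means
over the same points, not a product of means. The two factors are two independent thinnings of one
point set. These share no point with probability `(1 - p ^ 2) ^ M`, which tends to `1`, and disjoint
thinnings use independent points. The averaged product therefore converges to the product of
free-spin means (`tendsto_integral_quenchedMean_mul`), and the inequality passes to the limit
(`freeSpin_fkg`). -/

/-! ### Thinned spins over a fixed set of points -/

/-- The spin started at `s` that flips at the points `y i` with `i ∈ S`. -/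
noncomputable def thinnedPath {β : ℝ} {M : ℕ} (s : ℤˣ) (S : Finset (Fin M))
    (y : Fin M → TimeInterval β) : SpinPath β :=
  flipPath s ⟨S.card, fun i => y (S.orderEmbOfFin rfl i)⟩

theorem thinnedPath_apply {β : ℝ} {M : ℕ} (s : ℤˣ) (S : Finset (Fin M))
    (y : Fin M → TimeInterval β) (t : TimeInterval β) :
    (thinnedPath s S y).1 t = (((s * (-1) ^ (S.filter fun i => y i ≤ t).card : ℤˣ) : ℤ) : ℝ) := by
  have : pointCount (fun i => y (S.orderEmbOfFin rfl i)) t = (S.filter fun i => y i ≤ t).card := by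
    unfold pointCount
    rw [← Finset.card_map (S.orderEmbOfFin rfl).toEmbedding]
    congr 1
    ext j
    simp only [Finset.mem_map, Finset.mem_filter, Finset.mem_univ, true_and,
      RelEmbedding.coe_toEmbedding]
    constructor
    · rintro ⟨i, hi, rfl⟩
      exact ⟨S.orderEmbOfFin_mem rfl i, hi⟩
    · rintro ⟨hj, hy⟩
      have : j ∈ Set.range (S.orderEmbOfFin rfl) := by
        rw [Finset.range_orderEmbOfFin]; exact hj
      obtain ⟨i, rfl⟩ := this
      exact ⟨i, hy, rfl⟩
  rw [← this]
  rfl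

/-- The probability that the random subset of `Fin M` containing each element independently with
probability `p` is `S`. -/
def thinningWeight {M : ℕ} (p : ℝ) (S : Finset (Fin M)) : ℝ :=
  p ^ S.card * (1 - p) ^ (M - S.card)

/-- The mean of `A` over the spins that flip at a random subset of the points `y`. -/
noncomputable def quenchedMean {β : ℝ} {M : ℕ} (p : ℝ) (A : SpinPath β → ℝ)
    (y : Fin M → TimeInterval β) : ℝ :=
  ∑ s : ℤˣ, ∑ S : Finset (Fin M), 2⁻¹ * (thinningWeight p S * A (thinnedPath s S y))

theorem thinnedPath_comp_perm {β : ℝ} {M : ℕ} (τ : Equiv.Perm (Fin M)) (s : ℤˣ)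
    (S : Finset (Fin M)) (y : Fin M → TimeInterval β) :
    thinnedPath s S (y ∘ τ) = thinnedPath s (S.map τ.toEmbedding) y := by
  apply Subtype.ext
  funext t
  rw [thinnedPath_apply, thinnedPath_apply, Finset.filter_map, Finset.card_map]
  rfl

/-- The weight of a subset depends only on its size, so relabelling the points permutes the
summands. This allows the points to be taken sorted. -/
theorem quenchedMean_comp_perm {β : ℝ} {M : ℕ} (p : ℝ) (A : SpinPath β → ℝ)
    (τ : Equiv.Perm (Fin M)) (y : Fin M → TimeInterval β) :
    quenchedMean p A (y ∘ τ) = quenchedMean p A y := by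
  unfold quenchedMean
  refine Finset.sum_congr rfl fun s _ => ?_
  refine Fintype.sum_equiv τ.finsetCongr _ _ fun S => ?_
  rw [thinnedPath_comp_perm]
  simp [thinningWeight, Equiv.finsetCongr_apply]

/-! ### Sign sequences as a two-state Markov chain -/

/-- The positions at which a sequence of signs changes. -/
def signChanges {M : ℕ} (a : Fin (M + 1) → ℤˣ) : Finset (Fin M) :=
  Finset.univ.filter fun i => a i.castSucc ≠ a i.succ

theorem eq_mul_neg_one_pow_signChanges {M : ℕ} (a : Fin (M + 1) → ℤˣ) (k : Fin (M + 1)) :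
    a k = a 0 * (-1) ^ ((signChanges a).filter fun i => i.castSucc < k).card := by
  induction k using Fin.induction with
  | zero => simp
  | succ j ih =>
    have hsub : ((signChanges a).filter fun i => i.castSucc < j.succ) =
        if a j.castSucc ≠ a j.succ then
          insert j ((signChanges a).filter fun i => i.castSucc < j.castSucc)
        else (signChanges a).filter fun i => i.castSucc < j.castSucc := by
      ext i
      by_cases hij : i = j
      · subst hij
        split_ifs with h <;> simp_all [signChanges]
      · have : i.castSucc < j.succ ↔ i.castSucc < j.castSucc := by
          simp only [Fin.lt_def, Fin.val_castSucc, Fin.val_succ]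
          have := fun h => hij (Fin.ext h)
          omega
        split_ifs with h <;>
          simp only [Finset.mem_insert, Finset.mem_filter, this, hij, false_or]
    rw [hsub]
    split_ifs with h
    · rw [Finset.card_insert_of_notMem (by simp), pow_succ, ← mul_assoc, ← ih,
        Int.units_ne_iff_eq_neg.1 h.symm, mul_neg_one]
    · rw [← ih]
      exact (not_not.1 h).symm

/-- A sequence is recovered from its first sign and the parity of the changes so far; both sides
have `2 ^ (M + 1)` elements. -/
theorem bijective_head_signChanges (M : ℕ) :
    Function.Bijective fun a : Fin (M + 1) → ℤˣ => (a 0, signChanges a) := by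
  rw [Fintype.bijective_iff_injective_and_card]
  constructor
  · intro a b hab
    simp only [Prod.mk.injEq] at hab
    funext k
    rw [eq_mul_neg_one_pow_signChanges a k, eq_mul_neg_one_pow_signChanges b k, hab.1, hab.2]
  · simp [pow_succ, mul_comm]

/-- The Markov chain transition weights: `p` for a flip and `1 - p` for no flip. -/
def flipWeight (p : ℝ) (a b : ℤˣ) : ℝ := if a ≠ b then p else 1 - p

theorem flipWeight_nonneg {p : ℝ} (hp : 0 ≤ p) (hp' : p ≤ 1) (a b : ℤˣ) :
    0 ≤ flipWeight p a b := by
  unfold flipWeight; split_ifs <;> linarith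

/-- Equality holds except when the two transitions are opposite flips; min and max then replace two
flips by two non-flips. That case reads `p ^ 2 ≤ (1 - p) ^ 2` and is where `p ≤ 1 / 2` enters. -/
theorem flipWeight_mul_le {p : ℝ} (hp' : p ≤ 1 / 2) (a b a' b' : ℤˣ) :
    flipWeight p a b * flipWeight p a' b' ≤
      flipWeight p (a ⊓ a') (b ⊓ b') * flipWeight p (a ⊔ a') (b ⊔ b') := by
  have h1 : ((1 : ℤˣ) ⊓ -1) = -1 := by decide
  have h2 : ((-1 : ℤˣ) ⊓ 1) = -1 := by decide
  have h3 : ((1 : ℤˣ) ⊔ -1) = 1 := by decide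
  have h4 : ((-1 : ℤˣ) ⊔ 1) = 1 := by decide
  have h5 : (1 : ℤˣ) ≠ -1 := by decide
  have h6 : (-1 : ℤˣ) ≠ 1 := by decide
  have key : p * p ≤ (1 - p) * (1 - p) := by nlinarith
  have key' : p * (1 - p) = (1 - p) * p := mul_comm _ _
  rcases Int.units_eq_one_or a with rfl | rfl <;> rcases Int.units_eq_one_or b with rfl | rfl <;>
    rcases Int.units_eq_one_or a' with rfl | rfl <;>
    rcases Int.units_eq_one_or b' with rfl | rfl <;>
    simp [flipWeight, h1, h2, h3, h4, h5, h6, key, key'.le, key'.ge]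

theorem thinningWeight_signChanges {M : ℕ} (p : ℝ) (a : Fin (M + 1) → ℤˣ) :
    thinningWeight p (signChanges a) = ∏ i : Fin M, flipWeight p (a i.castSucc) (a i.succ) := by
  unfold flipWeight thinningWeight
  rw [Finset.prod_ite, Finset.prod_const, Finset.prod_const]
  congr 2
  have := Finset.card_filter_add_card_filter_not (s := (Finset.univ : Finset (Fin M)))
    (fun i => a i.castSucc ≠ a i.succ)
  simp only [Finset.card_univ, Fintype.card_fin] at this
  unfold signChanges
  omega

theorem quenchedMean_eq_sum_signs {β : ℝ} {M : ℕ} (p : ℝ) (A : SpinPath β → ℝ)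
    (y : Fin M → TimeInterval β) :
    quenchedMean p A y = ∑ a : Fin (M + 1) → ℤˣ,
      2⁻¹ * (thinningWeight p (signChanges a) * A (thinnedPath (a 0) (signChanges a) y)) := by
  unfold quenchedMean
  rw [← Fintype.sum_prod_type']
  exact ((bijective_head_signChanges M).sum_comp
    (fun q : ℤˣ × Finset (Fin M) => 2⁻¹ * (thinningWeight p q.2 * A (thinnedPath q.1 q.2 y)))).symm

/-- The number of points up to time `t`, as an index into a sequence of signs. -/
noncomputable def pointIndex {β : ℝ} {M : ℕ} (y : Fin M → TimeInterval β) (t : TimeInterval β) : Fin (M + 1) :=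
  ⟨pointCount y t, Nat.lt_succ_of_le (by
    simpa [pointCount] using Finset.card_le_univ (Finset.univ.filter fun i => y i ≤ t))⟩

/-- For sorted points the indices with `y i ≤ t` form an initial segment, so membership is decided
by comparing its size with those of `Iio i` and `Iic i`. -/
theorem castSucc_lt_pointIndex_iff {β : ℝ} {M : ℕ} {y : Fin M → TimeInterval β} (hy : Monotone y)
    (t : TimeInterval β) (i : Fin M) : i.castSucc < pointIndex y t ↔ y i ≤ t := by
  rw [Fin.lt_def]
  simp only [pointIndex, Fin.val_castSucc, pointCount]
  constructor
  · intro h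
    by_contra hi
    have : (Finset.univ.filter fun j => y j ≤ t) ⊆ Finset.Iio i := by
      intro j hj
      simp only [Finset.mem_filter, Finset.mem_univ, true_and] at hj
      rw [Finset.mem_Iio]
      by_contra hij
      exact hi ((hy (not_lt.1 hij)).trans hj)
    have := Finset.card_le_card this
    rw [Fin.card_Iio] at this
    omega
  · intro h
    have : Finset.Iic i ⊆ (Finset.univ.filter fun j => y j ≤ t) := by
      intro j hj
      simp only [Finset.mem_filter, Finset.mem_univ, true_and]
      exact (hy (Finset.mem_Iic.1 hj)).trans h
    have := Finset.card_le_card this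
    rw [Fin.card_Iic] at this
    omega

/-- The index `pointIndex y t` does not depend on `a`, so order, min and max of sign sequences
become pointwise order, min and max of spins. Repeated points are harmless: they only make the index
jump. -/
theorem thinnedPath_signChanges {β : ℝ} {M : ℕ} {y : Fin M → TimeInterval β} (hy : Monotone y)
    (a : Fin (M + 1) → ℤˣ) (t : TimeInterval β) :
    (thinnedPath (a 0) (signChanges a) y).1 t = ((a (pointIndex y t) : ℤ) : ℝ) := by
  rw [thinnedPath_apply, eq_mul_neg_one_pow_signChanges a (pointIndex y t)]
  simp only [castSucc_lt_pointIndex_iff hy]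

/-! ### The FKG inequality for fixed points -/

/-- Log-supermodularity of a weight on spins, for the pointwise lattice operations. -/
def IsLogSupermodular {β : ℝ} (w : SpinPath β → ℝ) : Prop :=
  ∀ σ σ' τ ρ : SpinPath β, (∀ t, τ.1 t = σ.1 t ⊓ σ'.1 t) → (∀ t, ρ.1 t = σ.1 t ⊔ σ'.1 t) →
    w σ * w σ' ≤ w τ * w ρ

theorem units_cast_mono : Monotone fun u : ℤˣ => ((u : ℤ) : ℝ) := fun _ _ h =>
  Int.cast_le.2 (Units.val_le_val.2 h)

theorem quenchedMean_fkg_of_monotone {β : ℝ} {M : ℕ} {p : ℝ} (hp : 0 ≤ p) (hp' : p ≤ 1 / 2)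
    {w f g : SpinPath β → ℝ} (hw0 : ∀ σ, 0 ≤ w σ) (hw : IsLogSupermodular w)
    (hf0 : ∀ σ, 0 ≤ f σ) (hg0 : ∀ σ, 0 ≤ g σ)
    (hf : ∀ σ σ' : SpinPath β, (∀ t, σ.1 t ≤ σ'.1 t) → f σ ≤ f σ')
    (hg : ∀ σ σ' : SpinPath β, (∀ t, σ.1 t ≤ σ'.1 t) → g σ ≤ g σ')
    {y : Fin M → TimeInterval β} (hy : Monotone y) :
    quenchedMean p (fun σ => w σ * f σ) y * quenchedMean p (fun σ => w σ * g σ) y ≤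
      quenchedMean p w y * quenchedMean p (fun σ => w σ * (f σ * g σ)) y := by
  simp only [quenchedMean_eq_sum_signs]
  set P : (Fin (M + 1) → ℤˣ) → SpinPath β := fun a => thinnedPath (a 0) (signChanges a) y with hP
  have hmono : ∀ a b, a ≤ b → ∀ t, (P a).1 t ≤ (P b).1 t := by
    intro a b hab t
    rw [hP]
    simp only [thinnedPath_signChanges hy]
    exact units_cast_mono (hab _)
  have hwt : ∀ a : Fin (M + 1) → ℤˣ, 0 ≤ thinningWeight p (signChanges a) := fun a => by
    rw [thinningWeight_signChanges]
    exact Finset.prod_nonneg fun i _ => flipWeight_nonneg hp (by linarith) _ _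
  have h := fkg (fun a => f (P a)) (fun a => g (P a))
    (fun a => 2⁻¹ * (thinningWeight p (signChanges a) * w (P a)))
    (fun a => mul_nonneg (by norm_num) (mul_nonneg (hwt a) (hw0 _)))
    (fun a => hf0 _) (fun a => hg0 _) (fun a b hab => hf _ _ (hmono a b hab))
    (fun a b hab => hg _ _ (hmono a b hab)) (by
      intro a b
      have h1 : thinningWeight p (signChanges a) * thinningWeight p (signChanges b) ≤
          thinningWeight p (signChanges (a ⊓ b)) * thinningWeight p (signChanges (a ⊔ b)) := by
        simp only [thinningWeight_signChanges, ← Finset.prod_mul_distrib]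
        exact Finset.prod_le_prod
          (fun i _ => mul_nonneg (flipWeight_nonneg hp (by linarith) _ _)
            (flipWeight_nonneg hp (by linarith) _ _))
          (fun i _ => flipWeight_mul_le hp' _ _ _ _)
      have h2 : w (P a) * w (P b) ≤ w (P (a ⊓ b)) * w (P (a ⊔ b)) := by
        apply hw
        · intro t
          simp only [hP, thinnedPath_signChanges hy]
          exact units_cast_mono.map_inf _ _
        · intro t
          simp only [hP, thinnedPath_signChanges hy]
          exact units_cast_mono.map_sup _ _
      have := mul_le_mul h1 h2 (mul_nonneg (hw0 _) (hw0 _)) (mul_nonneg (hwt _) (hwt _))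
      nlinarith [this])
  simp only [mul_assoc] at h ⊢
  exact h

theorem quenchedMean_fkg_of_nonneg {β : ℝ} {M : ℕ} {p : ℝ} (hp : 0 ≤ p) (hp' : p ≤ 1 / 2)
    {w f g : SpinPath β → ℝ} (hw0 : ∀ σ, 0 ≤ w σ) (hw : IsLogSupermodular w)
    (hf0 : ∀ σ, 0 ≤ f σ) (hg0 : ∀ σ, 0 ≤ g σ)
    (hf : ∀ σ σ' : SpinPath β, (∀ t, σ.1 t ≤ σ'.1 t) → f σ ≤ f σ')
    (hg : ∀ σ σ' : SpinPath β, (∀ t, σ.1 t ≤ σ'.1 t) → g σ ≤ g σ')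
    (y : Fin M → TimeInterval β) :
    quenchedMean p (fun σ => w σ * f σ) y * quenchedMean p (fun σ => w σ * g σ) y ≤
      quenchedMean p w y * quenchedMean p (fun σ => w σ * (f σ * g σ)) y := by
  have := quenchedMean_fkg_of_monotone hp hp' hw0 hw hf0 hg0 hf hg (Tuple.monotone_sort y)
  simpa only [quenchedMean_comp_perm] using this

/-- The FKG inequality for the spin that flips at a random subset of a fixed set of points. -/
theorem quenchedMean_fkg {β : ℝ} {M : ℕ} {p : ℝ} (hp : 0 ≤ p) (hp' : p ≤ 1 / 2)
    {w f g : SpinPath β → ℝ} (hw0 : ∀ σ, 0 ≤ w σ) (hw : IsLogSupermodular w)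
    {c d : ℝ} (hfc : ∀ σ, c ≤ f σ) (hgd : ∀ σ, d ≤ g σ)
    (hf : ∀ σ σ' : SpinPath β, (∀ t, σ.1 t ≤ σ'.1 t) → f σ ≤ f σ')
    (hg : ∀ σ σ' : SpinPath β, (∀ t, σ.1 t ≤ σ'.1 t) → g σ ≤ g σ')
    (y : Fin M → TimeInterval β) :
    quenchedMean p (fun σ => w σ * f σ) y * quenchedMean p (fun σ => w σ * g σ) y ≤
      quenchedMean p w y * quenchedMean p (fun σ => w σ * (f σ * g σ)) y := by
  -- Nonnegativity is obtained by subtracting lower bounds; the difference of the two sides of the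
  -- inequality is unchanged by adding constants to `f` and `g`.
  have h := quenchedMean_fkg_of_nonneg hp hp' (f := fun σ => f σ - c) (g := fun σ => g σ - d)
    hw0 hw (fun σ => sub_nonneg.2 (hfc σ)) (fun σ => sub_nonneg.2 (hgd σ))
    (fun σ σ' hσ => sub_le_sub_right (hf σ σ' hσ) c)
    (fun σ σ' hσ => sub_le_sub_right (hg σ σ' hσ) d) y
  have hlin : ∀ (A B : SpinPath β → ℝ) (e : ℝ), quenchedMean p (fun σ => A σ - e * B σ) y =
      quenchedMean p A y - e * quenchedMean p B y := by
    intro A B e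
    simp only [quenchedMean, Finset.mul_sum, ← Finset.sum_sub_distrib]
    refine Finset.sum_congr rfl fun s _ => Finset.sum_congr rfl fun S _ => by ring
  have e1 : (fun σ => w σ * (f σ - c)) = fun σ => w σ * f σ - c * w σ := by funext σ; ring
  have e2 : (fun σ => w σ * (g σ - d)) = fun σ => w σ * g σ - d * w σ := by funext σ; ring
  have e3 : (fun σ => w σ * ((f σ - c) * (g σ - d))) = fun σ =>
      (w σ * (f σ * g σ) - c * (w σ * g σ)) - d * (w σ * f σ - c * w σ) := by funext σ; ring
  rw [e1, e2, e3, hlin, hlin, hlin (fun σ => w σ * (f σ * g σ) - c * (w σ * g σ))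
    (fun σ => w σ * f σ - c * w σ), hlin, hlin] at h
  nlinarith [h]

/-! ### The Poisson process as a mixture of uniform samples -/

theorem timeMeasure_univ (β : ℝ) : timeMeasure β univ = ENNReal.ofReal β := by
  unfold timeMeasure
  rw [comap_subtype_coe_apply measurableSet_Icc, image_univ, Subtype.range_coe,
    Real.volume_Icc, sub_zero]

instance isFiniteMeasure_timeMeasure (β : ℝ) : IsFiniteMeasure (timeMeasure β) :=
  ⟨by rw [timeMeasure_univ]; exact ENNReal.ofReal_lt_top⟩

/-- The uniform distribution on `[0, β]`. -/
noncomputable def uniformTime (β : ℝ) : Measure (TimeInterval β) :=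
  (ENNReal.ofReal β)⁻¹ • timeMeasure β

theorem isProbabilityMeasure_uniformTime {β : ℝ} (hβ : 0 < β) :
    IsProbabilityMeasure (uniformTime β) :=
  ⟨by
    rw [uniformTime, Measure.smul_apply, timeMeasure_univ, smul_eq_mul,
      ENNReal.inv_mul_cancel (by simpa using hβ) ENNReal.ofReal_ne_top]⟩

theorem pi_smul_timeMeasure {β lam : ℝ} (hβ : 0 < β) (hlam : 0 ≤ lam) (n : ℕ) :
    Measure.pi (fun _ : Fin n => ENNReal.ofReal lam • timeMeasure β) =
      ENNReal.ofReal ((lam * β) ^ n) • Measure.pi (fun _ : Fin n => uniformTime β) := by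
  have := isProbabilityMeasure_uniformTime hβ
  have e : ENNReal.ofReal lam • timeMeasure β = ENNReal.ofReal (lam * β) • uniformTime β := by
    rw [uniformTime, smul_smul, ENNReal.ofReal_mul hlam, mul_assoc,
      ENNReal.mul_inv_cancel (by simpa using hβ) ENNReal.ofReal_ne_top, mul_one]
  have : IsFiniteMeasure (ENNReal.ofReal (lam * β) • uniformTime β) :=
    Measure.smul_finite _ ENNReal.ofReal_ne_top
  rw [e]
  refine Measure.pi_eq fun s _ => ?_
  simp only [Measure.smul_apply, Measure.pi_pi, smul_eq_mul, Finset.prod_mul_distrib,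
    Finset.prod_const, Finset.card_univ, Fintype.card_fin]
  rw [ENNReal.ofReal_pow (by positivity)]

theorem measurable_pointCount {β : ℝ} {n : ℕ} (t : TimeInterval β) :
    Measurable fun x : Fin n → TimeInterval β => pointCount x t := by
  simp only [pointCount, Finset.card_filter]
  refine Finset.measurable_sum _ fun i _ => ?_
  exact Measurable.ite (measurableSet_le (measurable_pi_apply i) measurable_const)
    measurable_const measurable_const

theorem measurable_flipPath_mk {β : ℝ} (s : ℤˣ) (n : ℕ) :
    Measurable fun x : Fin n → TimeInterval β => flipPath s ⟨n, x⟩ := by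
  refine Measurable.subtype_mk (measurable_pi_iff.2 fun t => ?_)
  exact (measurable_from_top (f := fun k : ℕ => (((s * (-1) ^ k : ℤˣ) : ℤ) : ℝ))).comp
    (measurable_pointCount t)

theorem measurable_sigma_mk {ι : Type*} {X : ι → Type*} [∀ i, MeasurableSpace (X i)] (i : ι) :
    Measurable (Sigma.mk i : X i → Sigma X) :=
  measurable_iff_le_map.2 (iInf_le _ i)

theorem measurable_flipPath {β : ℝ} (s : ℤˣ) : Measurable (flipPath (β := β) s) := by
  intro A hA
  rw [MeasurableSpace.measurableSet_iInf]
  exact fun n => measurable_flipPath_mk s n hA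

theorem poissonPoints_eq {β lam : ℝ} (hβ : 0 < β) (hlam : 0 ≤ lam) :
    poissonPoints β lam = Measure.sum fun n : ℕ =>
      ENNReal.ofReal (Real.exp (-(lam * β)) * (lam * β) ^ n / n.factorial) •
        (Measure.pi fun _ : Fin n => uniformTime β).map (Sigma.mk n) := by
  unfold poissonPoints
  congr 1
  funext n
  rw [pi_smul_timeMeasure hβ hlam, Measure.map_smul, smul_smul,
    ← ENNReal.ofReal_mul (by positivity)]
  congr 2
  ring

theorem hasSum_poissonWeight (r : ℝ) :
    HasSum (fun n : ℕ => Real.exp (-r) * r ^ n / n.factorial) 1 := by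
  have := (NormedSpace.expSeries_div_hasSum_exp r).mul_left (Real.exp (-r))
  rw [← Real.exp_eq_exp_ℝ, ← Real.exp_add] at this
  simpa [mul_div_assoc] using this

theorem isProbabilityMeasure_poissonPoints {β lam : ℝ} (hβ : 0 < β) (hlam : 0 ≤ lam) :
    IsProbabilityMeasure (poissonPoints β lam) := by
  have := isProbabilityMeasure_uniformTime hβ
  refine ⟨?_⟩
  rw [poissonPoints_eq hβ hlam, Measure.sum_apply _ MeasurableSet.univ]
  have : ∀ n : ℕ, ((Measure.pi fun _ : Fin n => uniformTime β).map (Sigma.mk n))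
      (univ : Set (Σ n : ℕ, Fin n → TimeInterval β)) = 1 := fun n => by
    rw [Measure.map_apply (measurable_sigma_mk n) MeasurableSet.univ, preimage_univ, measure_univ]
  simp only [Measure.smul_apply, this, smul_eq_mul, mul_one]
  rw [← ENNReal.ofReal_tsum_of_nonneg (fun n => by positivity) (hasSum_poissonWeight _).summable,
    (hasSum_poissonWeight _).tsum_eq, ENNReal.ofReal_one]

theorem integrable_of_bounded {α : Type*} [MeasurableSpace α] {μ : Measure α} [IsFiniteMeasure μ]
    {A : α → ℝ} (hA : Measurable A) {C : ℝ} (hC : ∀ x, |A x| ≤ C) : Integrable A μ :=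
  Integrable.of_bound hA.aestronglyMeasurable C (Eventually.of_forall hC)

/-- The mean of `A` over the two spins flipping at `n` independent uniform points. -/
noncomputable def uniformFlipMean {β : ℝ} (A : SpinPath β → ℝ) (s : ℤˣ) (n : ℕ) : ℝ :=
  ∫ x, A (flipPath s ⟨n, x⟩) ∂(Measure.pi fun _ : Fin n => uniformTime β)

theorem abs_uniformFlipMean_le {β : ℝ} (hβ : 0 < β) {A : SpinPath β → ℝ} {C : ℝ}
    (hC : ∀ σ, |A σ| ≤ C) (s : ℤˣ) (n : ℕ) : |uniformFlipMean A s n| ≤ C := by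
  have := isProbabilityMeasure_uniformTime hβ
  have h := norm_integral_le_of_norm_le_const
    (μ := Measure.pi fun _ : Fin n => uniformTime β) (f := fun x => A (flipPath s ⟨n, x⟩))
    (Eventually.of_forall fun x => hC _)
  simpa [uniformFlipMean] using h

theorem integral_freeSpin {β lam : ℝ} (hβ : 0 < β) (hlam : 0 ≤ lam) {A : SpinPath β → ℝ}
    (hA : Measurable A) {C : ℝ} (hC : ∀ σ, |A σ| ≤ C) :
    ∫ σ, A σ ∂(freeSpin β lam) = ∑ s : ℤˣ, 2⁻¹ *
      ∑' n : ℕ, Real.exp (-(lam * β)) * (lam * β) ^ n / n.factorial * uniformFlipMean A s n := by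
  have := isProbabilityMeasure_poissonPoints hβ hlam
  have hm : ∀ s : ℤˣ, IsFiniteMeasure ((poissonPoints β lam).map (flipPath s)) := fun s =>
    inferInstance
  rw [freeSpin, integral_finsetSum_measure fun s _ =>
    (integrable_of_bounded hA hC).smul_measure (by simp)]
  refine Finset.sum_congr rfl fun s _ => ?_
  rw [integral_smul_measure, integral_map (measurable_flipPath s).aemeasurable
    hA.aestronglyMeasurable]
  simp only [ENNReal.toReal_inv, ENNReal.toReal_ofNat, smul_eq_mul]
  congr 1
  have hAs : Measurable fun x => A (flipPath s x) := hA.comp (measurable_flipPath s)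
  have hint : Integrable (fun x => A (flipPath s x)) (poissonPoints β lam) :=
    integrable_of_bounded hAs fun x => hC _
  rw [poissonPoints_eq hβ hlam] at hint ⊢
  rw [integral_sum_measure hint]
  refine tsum_congr fun n => ?_
  rw [integral_smul_measure, integral_map (measurable_sigma_mk n).aemeasurable
    hAs.aestronglyMeasurable, ENNReal.toReal_ofReal (by positivity), smul_eq_mul]
  rfl

/-! ### Measurability and integrability of the field term -/

/-- The grid point `(k + 1) / (n + 1)`, projected to `[0, β]`. -/
noncomputable def rightGrid {β : ℝ} (hβ : 0 < β) (n : ℕ) (k : ℤ) : TimeInterval β :=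
  projIcc 0 β hβ.le (((k : ℝ) + 1) / ((n : ℝ) + 1))

/-- The `+ 1` in the grid point puts the approximation on the right of `t`, at distance at most `1 /
(n + 1)` before projection; this is the side on which spins are continuous. -/
theorem tendsto_rightGrid {β : ℝ} (hβ : 0 < β) (t : TimeInterval β) :
    Tendsto (fun n : ℕ => rightGrid hβ n ⌊((n : ℝ) + 1) * t.1⌋) atTop (𝓝[≥] t) := by
  have hlow : ∀ n : ℕ, t.1 ≤ ((⌊((n : ℝ) + 1) * t.1⌋ : ℝ) + 1) / ((n : ℝ) + 1) := fun n => by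
    rw [le_div_iff₀ (by positivity), mul_comm]
    exact (Int.lt_floor_add_one _).le
  refine tendsto_nhdsWithin_iff.2 ⟨?_, Eventually.of_forall fun n => ?_⟩
  · have h1 : Tendsto (fun n : ℕ => ((⌊((n : ℝ) + 1) * t.1⌋ : ℝ) + 1) / ((n : ℝ) + 1)) atTop
        (𝓝 t.1) := by
      have h2 : Tendsto (fun n : ℕ => t.1 + 1 / ((n : ℝ) + 1)) atTop (𝓝 (t.1 + 0)) :=
        tendsto_const_nhds.add tendsto_one_div_add_atTop_nhds_zero_nat
      rw [add_zero] at h2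
      refine tendsto_of_tendsto_of_tendsto_of_le_of_le tendsto_const_nhds h2 hlow fun n => ?_
      have hn : (0 : ℝ) < (n : ℝ) + 1 := by positivity
      show _ / _ ≤ _
      rw [div_le_iff₀ hn, add_mul t.1, one_div, inv_mul_cancel₀ hn.ne', mul_comm t.1]
      linarith [Int.floor_le (((n : ℝ) + 1) * t.1)]
    have h3 := (continuous_projIcc (h := hβ.le)).tendsto t.1 |>.comp h1
    rwa [projIcc_val] at h3
  · show t ≤ _
    have := monotone_projIcc hβ.le (hlow n)
    rwa [projIcc_val] at this

theorem measurable_spin_apply {β : ℝ} (t : TimeInterval β) :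
    Measurable fun σ : SpinPath β => σ.1 t :=
  (measurable_pi_apply t).comp measurable_subtype_coe

/-- Right continuity makes the evaluation a pointwise limit of evaluations at countably many grid
times, each measurable in the spin. -/
theorem measurable_uncurry_spin {β : ℝ} (hβ : 0 < β) :
    Measurable fun q : SpinPath β × TimeInterval β => q.1.1 q.2 := by
  refine measurable_of_tendsto_metrizable
    (f := fun (n : ℕ) (q : SpinPath β × TimeInterval β) =>
      q.1.1 (rightGrid hβ n ⌊((n : ℝ) + 1) * q.2.1⌋)) (fun n => ?_) ?_
  · have h1 : Measurable fun q : SpinPath β × ℤ => q.1.1 (rightGrid hβ n q.2) :=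
      measurable_from_prod_countable_left fun k =>
        measurable_spin_apply (rightGrid hβ n k)
    have h2 : Measurable fun q : SpinPath β × TimeInterval β =>
        (q.1, ⌊((n : ℝ) + 1) * q.2.1⌋) :=
      measurable_fst.prodMk
        ((measurable_const.mul (measurable_subtype_coe.comp measurable_snd)).floor)
    exact h1.comp h2
  · rw [tendsto_pi_nhds]
    intro q
    exact (q.1.2.right_continuous q.2).tendsto.comp (tendsto_rightGrid hβ q.2)

theorem measurable_spin {β : ℝ} (hβ : 0 < β) (σ : SpinPath β) : Measurable σ.1 :=
  (measurable_uncurry_spin hβ).comp measurable_prodMk_left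

theorem abs_spin (β : ℝ) (σ : SpinPath β) (t : TimeInterval β) : |σ.1 t| = 1 := by
  rcases σ.2.values t with h | h <;> rw [h] <;> simp

theorem measurable_fieldDot {β : ℝ} (hβ : 0 < β) {h : TimeInterval β → ℝ}
    (hh : AEStronglyMeasurable h (timeMeasure β)) : Measurable (fieldDot h) := by
  have e : fieldDot h = fun σ : SpinPath β => ∫ t, hh.mk h t * σ.1 t ∂(timeMeasure β) := by
    funext σ
    refine integral_congr_ae ?_
    filter_upwards [hh.ae_eq_mk] with t ht
    rw [ht]
  rw [e]
  have hm : StronglyMeasurable fun q : SpinPath β × TimeInterval β => hh.mk h q.2 * q.1.1 q.2 :=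
    ((hh.stronglyMeasurable_mk.measurable.comp measurable_snd).mul
      (measurable_uncurry_spin hβ)).stronglyMeasurable
  exact hm.integral_prod_right'.measurable

theorem integrable_field_mul_spin {β : ℝ} (hβ : 0 < β) {h : TimeInterval β → ℝ}
    (hh : MemLp h ⊤ (timeMeasure β)) (σ : SpinPath β) :
    Integrable (fun t => h t * σ.1 t) (timeMeasure β) :=
  (hh.integrable le_top).mul_bdd (c := 1) (measurable_spin hβ σ).aestronglyMeasurable
    (Eventually.of_forall fun t => (abs_spin β σ t).le)

theorem exists_fieldDot_le {β : ℝ} (hβ : 0 < β) {h : TimeInterval β → ℝ}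
    (hh : MemLp h ⊤ (timeMeasure β)) : ∃ C, ∀ σ, fieldDot h σ ≤ C := by
  refine ⟨∫ t, |h t| ∂(timeMeasure β), fun σ => ?_⟩
  refine integral_mono (integrable_field_mul_spin hβ hh σ) (hh.integrable le_top).abs fun t => ?_
  calc h t * σ.1 t ≤ |h t * σ.1 t| := le_abs_self _
    _ = |h t| := by rw [abs_mul, abs_spin, mul_one]

/-! ### Log-supermodularity of the field and periodic weights -/

theorem measurableSet_periodicEvent {β : ℝ} (hβ : 0 < β) : MeasurableSet (periodicEvent hβ) :=
  measurableSet_eq_fun (measurable_spin_apply _) (measurable_spin_apply _)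

/-- Since min plus max equals the sum, the exponents agree and equality holds, whatever the sign of
`h`. -/
theorem isLogSupermodular_exp_fieldDot {β : ℝ} (hβ : 0 < β) {h : TimeInterval β → ℝ}
    (hh : MemLp h ⊤ (timeMeasure β)) : IsLogSupermodular fun σ => Real.exp (fieldDot h σ) := by
  intro σ σ' τ ρ hτ hρ
  rw [← Real.exp_add, ← Real.exp_add]
  refine (congrArg Real.exp ?_).le
  have hi := integrable_field_mul_spin hβ hh
  unfold fieldDot
  rw [← integral_add (hi _) (hi _), ← integral_add (hi _) (hi _)]
  refine integral_congr_ae (Eventually.of_forall fun t => ?_)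
  show h t * σ.1 t + h t * σ'.1 t = h t * τ.1 t + h t * ρ.1 t
  rw [hτ, hρ, ← mul_add, ← mul_add, min_add_max]

theorem IsLogSupermodular.indicator_periodicEvent {β : ℝ} (hβ : 0 < β) {w : SpinPath β → ℝ}
    (hw0 : ∀ σ, 0 ≤ w σ) (hw : IsLogSupermodular w) :
    IsLogSupermodular ((periodicEvent hβ).indicator w) := by
  intro σ σ' τ ρ hτ hρ
  have h0 : ∀ σ, 0 ≤ (periodicEvent hβ).indicator w σ := fun σ =>
    indicator_nonneg (fun σ _ => hw0 σ) σ
  by_cases h1 : σ ∈ periodicEvent hβ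
  · by_cases h2 : σ' ∈ periodicEvent hβ
    · have h3 : τ ∈ periodicEvent hβ := by
        simp only [periodicEvent, mem_ofPred_eq, hτ] at h1 h2 ⊢
        rw [h1, h2]
      have h4 : ρ ∈ periodicEvent hβ := by
        simp only [periodicEvent, mem_ofPred_eq, hρ] at h1 h2 ⊢
        rw [h1, h2]
      simpa only [indicator_of_mem h1, indicator_of_mem h2, indicator_of_mem h3,
        indicator_of_mem h4] using hw σ σ' τ ρ hτ hρ
    · rw [indicator_of_notMem h2, mul_zero]
      exact mul_nonneg (h0 _) (h0 _)
  · rw [indicator_of_notMem h1, zero_mul]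
    exact mul_nonneg (h0 _) (h0 _)

/-! ### Decoupling two thinnings of the same points -/

theorem map_comp_injective_pi_uniformTime {β : ℝ} (hβ : 0 < β) {n M : ℕ} {e : Fin n → Fin M}
    (he : Function.Injective e) :
    (Measure.pi fun _ : Fin M => uniformTime β).map (fun y i => y (e i)) =
      Measure.pi fun _ : Fin n => uniformTime β := by
  have := isProbabilityMeasure_uniformTime hβ
  have h := (ProbabilityTheory.iIndepFun_pi (μ := fun _ : Fin M => uniformTime β)
    (X := fun _ t => t) fun _ => aemeasurable_id).precomp he
  rw [ProbabilityTheory.iIndepFun_iff_map_fun_eq_pi_map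
    fun i => (measurable_pi_apply (e i)).aemeasurable] at h
  rw [h]
  congr 1
  funext i
  exact (measurePreserving_eval (fun _ : Fin M => uniformTime β) (e i)).map_eq

theorem measurable_thinnedPath {β : ℝ} {M : ℕ} (s : ℤˣ) (S : Finset (Fin M)) :
    Measurable fun y : Fin M → TimeInterval β => thinnedPath s S y :=
  (measurable_flipPath_mk s S.card).comp (measurable_pi_iff.2 fun _ => measurable_pi_apply _)

theorem integral_thinnedPath {β : ℝ} (hβ : 0 < β) {M : ℕ} {A : SpinPath β → ℝ}
    (hA : Measurable A) (s : ℤˣ) (S : Finset (Fin M)) :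
    ∫ y, A (thinnedPath s S y) ∂(Measure.pi fun _ : Fin M => uniformTime β) =
      uniformFlipMean A s S.card := by
  have hm : Measurable fun (y : Fin M → TimeInterval β) i => y (S.orderEmbOfFin rfl i) :=
    measurable_pi_iff.2 fun _ => measurable_pi_apply _
  unfold uniformFlipMean
  rw [← map_comp_injective_pi_uniformTime hβ (S.orderEmbOfFin rfl).injective]
  exact (integral_map hm.aemeasurable
    (hA.comp (measurable_flipPath_mk s S.card)).aestronglyMeasurable).symm

/-- The two spins depend on disjoint blocks of independent coordinates. -/
theorem integral_thinnedPath_mul_of_disjoint {β : ℝ} (hβ : 0 < β) {M : ℕ} {A B : SpinPath β → ℝ}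
    (hA : Measurable A) (hB : Measurable B) (s s' : ℤˣ) {S S' : Finset (Fin M)}
    (hS : Disjoint S S') :
    ∫ y, A (thinnedPath s S y) * B (thinnedPath s' S' y)
        ∂(Measure.pi fun _ : Fin M => uniformTime β) =
      uniformFlipMean A s S.card * uniformFlipMean B s' S'.card := by
  have := isProbabilityMeasure_uniformTime hβ
  have h := (ProbabilityTheory.iIndepFun_pi (μ := fun _ : Fin M => uniformTime β)
    (X := fun _ t => t) fun _ => aemeasurable_id).indepFun_finset S S' hS
    fun i => measurable_pi_apply i
  have hm : ∀ {D : SpinPath β → ℝ}, Measurable D → ∀ (s : ℤˣ) (S : Finset (Fin M)),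
      Measurable fun z : S → TimeInterval β => D (flipPath s ⟨S.card,
        fun i => z ⟨S.orderEmbOfFin rfl i, S.orderEmbOfFin_mem rfl i⟩⟩) := fun hD s S =>
    hD.comp ((measurable_flipPath_mk s S.card).comp
      (measurable_pi_iff.2 fun _ => measurable_pi_apply _))
  have h' := h.comp (hm hA s S) (hm hB s' S')
  rw [← integral_thinnedPath hβ hA, ← integral_thinnedPath hβ hB]
  exact h'.integral_fun_mul_eq_mul_integral
    (hA.comp (measurable_thinnedPath s S)).aestronglyMeasurable
    (hB.comp (measurable_thinnedPath s' S')).aestronglyMeasurable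

theorem sum_thinningWeight (M : ℕ) (p : ℝ) : ∑ S : Finset (Fin M), thinningWeight p S = 1 := by
  have := Fintype.sum_pow_mul_eq_add_pow (Fin M) p (1 - p)
  simpa [thinningWeight] using this

theorem thinningWeight_nonneg {M : ℕ} {p : ℝ} (hp : 0 ≤ p) (hp' : p ≤ 1) (S : Finset (Fin M)) :
    0 ≤ thinningWeight p S :=
  mul_nonneg (pow_nonneg hp _) (pow_nonneg (by linarith) _)

/-- Each point of `S` must be rejected, at cost `1 - p`; the thinning of `Sᶜ` is unconstrained and
has total mass `1`. -/
theorem sum_thinningWeight_disjoint {M : ℕ} (p : ℝ) (S : Finset (Fin M)) :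
    ∑ S' : Finset (Fin M), (if Disjoint S S' then thinningWeight p S' else 0) =
      (1 - p) ^ S.card := by
  rw [← Finset.sum_filter]
  have e : (Finset.univ.filter fun S' => Disjoint S S') = Sᶜ.powerset := by
    ext S'
    simp [Finset.subset_compl_iff_disjoint_left]
  rw [e]
  have h := Finset.sum_pow_mul_eq_add_pow p (1 - p) Sᶜ
  rw [add_sub_cancel, one_pow] at h
  suffices ∑ S' ∈ Sᶜ.powerset, thinningWeight p S' = (1 - p) ^ S.card *
      ∑ S' ∈ Sᶜ.powerset, p ^ S'.card * (1 - p) ^ (Sᶜ.card - S'.card) by rw [this, h, mul_one]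
  rw [Finset.mul_sum]
  refine Finset.sum_congr rfl fun S' hS' => ?_
  have h1 := Finset.card_le_card (Finset.mem_powerset.1 hS')
  have h2 := Finset.card_add_card_compl S
  rw [Fintype.card_fin] at h2
  have h3 : M - S'.card = S.card + (Sᶜ.card - S'.card) := by omega
  rw [thinningWeight, h3, pow_add]
  ring

/-- Independently for each point, the chance of not being kept by both thinnings is `1 - p ^ 2`. -/
theorem sum_sum_thinningWeight_disjoint (M : ℕ) (p : ℝ) :
    ∑ S : Finset (Fin M), ∑ S' : Finset (Fin M), thinningWeight p S *
      (if Disjoint S S' then thinningWeight p S' else 0) = (1 - p ^ 2) ^ M := by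
  simp only [← Finset.mul_sum, sum_thinningWeight_disjoint]
  have h := Fintype.sum_pow_mul_eq_add_pow (Fin M) (p * (1 - p)) (1 - p)
  rw [Fintype.card_fin] at h
  rw [show 1 - p ^ 2 = p * (1 - p) + (1 - p) by ring, ← h]
  refine Finset.sum_congr rfl fun S _ => ?_
  rw [thinningWeight, mul_pow]
  ring

/-- The mean of `A` over the spins flipping at a binomial number of independent uniform points. -/
noncomputable def binomialFlipMean {β : ℝ} (M : ℕ) (p : ℝ) (A : SpinPath β → ℝ) : ℝ :=
  ∑ s : ℤˣ, ∑ S : Finset (Fin M), 2⁻¹ * (thinningWeight p S * uniformFlipMean A s S.card)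

/-- Both products expand over pairs of thinnings. Disjoint pairs cancel exactly; each other pair
costs at most `2 * (C * D)`, and such pairs have total weight `1 - (1 - p ^ 2) ^ M`. -/
theorem abs_integral_quenchedMean_mul_sub_le {β : ℝ} (hβ : 0 < β) {M : ℕ} {p : ℝ} (hp : 0 ≤ p)
    (hp' : p ≤ 1) {A B : SpinPath β → ℝ} (hA : Measurable A) (hB : Measurable B) {C D : ℝ}
    (hC : ∀ σ, |A σ| ≤ C) (hD : ∀ σ, |B σ| ≤ D) :
    |∫ y, quenchedMean p A y * quenchedMean p B y ∂(Measure.pi fun _ : Fin M => uniformTime β) -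
      binomialFlipMean M p A * binomialFlipMean M p B| ≤
      2 * (C * D) * (1 - (1 - p ^ 2) ^ M) := by
  have := isProbabilityMeasure_uniformTime hβ
  set U := Measure.pi fun _ : Fin M => uniformTime β with hU
  let J := ℤˣ × Finset (Fin M)
  let wt : J → ℝ := fun j => 2⁻¹ * thinningWeight p j.2
  have hwt : ∀ j, 0 ≤ wt j := fun j => mul_nonneg (by norm_num) (thinningWeight_nonneg hp hp' _)
  have hQ : ∀ (A : SpinPath β → ℝ) (y : Fin M → TimeInterval β),
      quenchedMean p A y = ∑ j : J, wt j * A (thinnedPath j.1 j.2 y) := fun A y => by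
    rw [quenchedMean, ← Fintype.sum_prod_type']
    exact Finset.sum_congr rfl fun j _ => (mul_assoc _ _ _).symm
  have hN : ∀ (A : SpinPath β → ℝ),
      binomialFlipMean M p A = ∑ j : J, wt j * uniformFlipMean A j.1 j.2.card := fun A => by
    rw [binomialFlipMean, ← Fintype.sum_prod_type']
    exact Finset.sum_congr rfl fun j _ => (mul_assoc _ _ _).symm
  have hC0 : 0 ≤ C := (abs_nonneg _).trans (hC (thinnedPath 1 ∅ (Fin.elim0 : Fin 0 → _)))
  have hAB : ∀ (j k : J) y, |A (thinnedPath j.1 j.2 y) * B (thinnedPath k.1 k.2 y)| ≤ C * D :=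
    fun j k y => by
      rw [abs_mul]; exact mul_le_mul (hC _) (hD _) (abs_nonneg _) hC0
  have hint : ∀ j k : J, Integrable
      (fun y => A (thinnedPath j.1 j.2 y) * B (thinnedPath k.1 k.2 y)) U := fun j k =>
    integrable_of_bounded ((hA.comp (measurable_thinnedPath _ _)).mul
      (hB.comp (measurable_thinnedPath _ _))) (hAB j k)
  have h1 : ∫ y, quenchedMean p A y * quenchedMean p B y ∂U = ∑ j : J, ∑ k : J, wt j * wt k *
      ∫ y, A (thinnedPath j.1 j.2 y) * B (thinnedPath k.1 k.2 y) ∂U := by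
    have e : ∀ y, quenchedMean p A y * quenchedMean p B y = ∑ j : J, ∑ k : J, wt j * wt k *
        (A (thinnedPath j.1 j.2 y) * B (thinnedPath k.1 k.2 y)) := fun y => by
      rw [hQ, hQ, Finset.sum_mul_sum]
      exact Finset.sum_congr rfl fun j _ => Finset.sum_congr rfl fun k _ => by ring
    simp only [e]
    rw [integral_finsetSum _ fun j _ => integrable_finsetSum _ fun k _ =>
      (hint j k).const_mul _]
    refine Finset.sum_congr rfl fun j _ => ?_
    rw [integral_finsetSum _ fun k _ => (hint j k).const_mul _]
    exact Finset.sum_congr rfl fun k _ => integral_const_mul _ _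
  have h2 : binomialFlipMean M p A * binomialFlipMean M p B = ∑ j : J, ∑ k : J, wt j * wt k *
      (uniformFlipMean A j.1 j.2.card * uniformFlipMean B k.1 k.2.card) := by
    rw [hN, hN, Finset.sum_mul_sum]
    exact Finset.sum_congr rfl fun j _ => Finset.sum_congr rfl fun k _ => by ring
  have h3 : ∀ j k : J,
      |(∫ y, A (thinnedPath j.1 j.2 y) * B (thinnedPath k.1 k.2 y) ∂U) -
        uniformFlipMean A j.1 j.2.card * uniformFlipMean B k.1 k.2.card| ≤
      if Disjoint j.2 k.2 then 0 else 2 * (C * D) := by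
    intro j k
    split_ifs with hd
    · rw [integral_thinnedPath_mul_of_disjoint hβ hA hB _ _ hd, sub_self, abs_zero]
    · have i1 : |∫ y, A (thinnedPath j.1 j.2 y) * B (thinnedPath k.1 k.2 y) ∂U| ≤ C * D := by
        have h := norm_integral_le_of_norm_le_const (μ := U)
          (f := fun y => A (thinnedPath j.1 j.2 y) * B (thinnedPath k.1 k.2 y))
          (Eventually.of_forall fun y => hAB j k y)
        simpa [hU] using h
      have i2 : |uniformFlipMean A j.1 j.2.card * uniformFlipMean B k.1 k.2.card| ≤ C * D := by
        rw [abs_mul]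
        exact mul_le_mul (abs_uniformFlipMean_le hβ hC _ _) (abs_uniformFlipMean_le hβ hD _ _)
          (abs_nonneg _) hC0
      linarith [abs_sub (∫ y, A (thinnedPath j.1 j.2 y) * B (thinnedPath k.1 k.2 y) ∂U)
        (uniformFlipMean A j.1 j.2.card * uniformFlipMean B k.1 k.2.card)]
  have h4 : ∑ j : J, ∑ k : J, wt j * wt k * (if Disjoint j.2 k.2 then 0 else 2 * (C * D)) =
      2 * (C * D) * (1 - (1 - p ^ 2) ^ M) := by
    -- Writing `1` as the total mass of two thinnings turns the right-hand side into a sum over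
    -- intersecting pairs.
    have e1 : (1 : ℝ) = ∑ S : Finset (Fin M), ∑ S' : Finset (Fin M),
        thinningWeight p S * thinningWeight p S' := by
      rw [← Finset.sum_mul_sum, sum_thinningWeight, one_mul]
    rw [← sum_sum_thinningWeight_disjoint]
    nth_rewrite 1 [e1]
    rw [← Finset.sum_sub_distrib, Fintype.sum_prod_type]
    have e2 : ∀ (s : ℤˣ) (S : Finset (Fin M)), ∑ k : J, wt (s, S) * wt k *
        (if Disjoint S k.2 then 0 else 2 * (C * D)) = 2⁻¹ * (2 * (C * D) *
          (∑ S' : Finset (Fin M), thinningWeight p S * thinningWeight p S' -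
          ∑ S' : Finset (Fin M), thinningWeight p S *
            (if Disjoint S S' then thinningWeight p S' else 0))) := by
      intro s S
      have e3 : ∀ s' : ℤˣ, ∑ S' : Finset (Fin M), wt (s, S) * wt (s', S') *
          (if Disjoint S S' then 0 else 2 * (C * D)) = 2⁻¹ * (2⁻¹ * (2 * (C * D) *
          (∑ S' : Finset (Fin M), thinningWeight p S * thinningWeight p S' -
          ∑ S' : Finset (Fin M), thinningWeight p S *
            (if Disjoint S S' then thinningWeight p S' else 0)))) := by
        intro s'
        rw [← Finset.sum_sub_distrib]
        simp only [Finset.mul_sum]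
        refine Finset.sum_congr rfl fun S' _ => ?_
        simp only [wt]
        split_ifs <;> ring
      rw [Fintype.sum_prod_type]
      simp only [e3, Finset.sum_const, Finset.card_univ, Fintype.card_units_int, nsmul_eq_mul]
      push_cast
      ring
    simp only [e2, ← Finset.mul_sum, Finset.sum_const, Finset.card_univ, Fintype.card_units_int,
      nsmul_eq_mul]
    push_cast
    ring
  rw [h1, h2, ← h4, ← Finset.sum_sub_distrib]
  refine (Finset.abs_sum_le_sum_abs _ _).trans (Finset.sum_le_sum fun j _ => ?_)
  rw [← Finset.sum_sub_distrib]
  refine (Finset.abs_sum_le_sum_abs _ _).trans (Finset.sum_le_sum fun k _ => ?_)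
  rw [← mul_sub, abs_mul, abs_of_nonneg (mul_nonneg (hwt j) (hwt k))]
  exact mul_le_mul_of_nonneg_left (h3 j k) (mul_nonneg (hwt j) (hwt k))

/-! ### The Poisson limit -/

theorem binomialFlipMean_eq_tsum {β : ℝ} (M : ℕ) (p : ℝ) (A : SpinPath β → ℝ) :
    binomialFlipMean M p A = ∑ s : ℤˣ, 2⁻¹ *
      ∑' n : ℕ, M.choose n * p ^ n * (1 - p) ^ (M - n) * uniformFlipMean A s n := by
  unfold binomialFlipMean thinningWeight
  refine Finset.sum_congr rfl fun s _ => ?_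
  rw [← Finset.mul_sum]
  congr 1
  have h := Finset.sum_powerset_apply_card (x := (Finset.univ : Finset (Fin M)))
    (fun n => p ^ n * (1 - p) ^ (M - n) * uniformFlipMean A s n)
  rw [Finset.powerset_univ, Finset.card_univ, Fintype.card_fin] at h
  -- Terms with `n > M` vanish through the binomial coefficient, so the truncated subtraction `M -
  -- n` does no harm.
  rw [h, tsum_eq_sum (s := Finset.range (M + 1)) fun n hn => by
    rw [Nat.choose_eq_zero_of_lt (by simpa [Nat.lt_succ_iff] using hn)]; simp]
  refine Finset.sum_congr rfl fun n _ => ?_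
  rw [nsmul_eq_mul]
  ring

/-- Binomial weights converge to Poisson weights, and `choose M n ≤ M ^ n / n!` gives the summable
bound `r ^ n / n! * C` for dominated convergence. -/
theorem tendsto_binomialFlipMean {β lam : ℝ} (hβ : 0 < β) (hlam : 0 ≤ lam) {A : SpinPath β → ℝ}
    (hA : Measurable A) {C : ℝ} (hC : ∀ σ, |A σ| ≤ C) :
    Tendsto (fun M : ℕ => binomialFlipMean M (lam * β / M) A) atTop
      (𝓝 (∫ σ, A σ ∂(freeSpin β lam))) := by
  rw [integral_freeSpin hβ hlam hA hC]
  simp only [binomialFlipMean_eq_tsum]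
  set r := lam * β with hr
  have hr0 : 0 ≤ r := by positivity
  refine tendsto_finsetSum _ fun s _ => Tendsto.const_mul _ ?_
  refine tendsto_tsum_of_dominated_convergence (bound := fun n => r ^ n / n.factorial * C)
    ((NormedSpace.expSeries_div_summable r).mul_right C) (fun n => ?_) ?_
  · refine Tendsto.mul_const _
      (ProbabilityTheory.tendsto_choose_mul_pow_of_tendsto_mul_atTop n ?_)
    refine tendsto_const_nhds.congr' ?_
    filter_upwards [eventually_gt_atTop 0] with M hM
    have : (M : ℝ) ≠ 0 := by exact_mod_cast hM.ne'
    field_simp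
  · filter_upwards [eventually_gt_atTop 0, eventually_ge_atTop ⌈r⌉₊] with M hM hMr n
    have hM' : (0 : ℝ) < M := by exact_mod_cast hM
    have hp0 : 0 ≤ r / M := by positivity
    have hp1 : r / M ≤ 1 := by
      rw [div_le_one hM']; exact Nat.ceil_le.1 hMr
    rw [Real.norm_eq_abs, abs_mul]
    refine mul_le_mul ?_ (abs_uniformFlipMean_le hβ hC s n) (abs_nonneg _) (by positivity)
    have h1 : 0 ≤ (1 - r / M) ^ (M - n) := pow_nonneg (by linarith) _
    have h2 : (1 - r / M) ^ (M - n) ≤ 1 := pow_le_one₀ (by linarith) (by linarith)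
    rw [abs_of_nonneg (by positivity)]
    calc (M.choose n : ℝ) * (r / M) ^ n * (1 - r / M) ^ (M - n)
        ≤ (M.choose n : ℝ) * (r / M) ^ n * 1 := by gcongr
      _ ≤ (M : ℝ) ^ n / n.factorial * (r / M) ^ n * 1 := by
        gcongr; exact Nat.choose_le_pow_div n M
      _ = r ^ n / n.factorial := by
        rw [div_pow]; field_simp

/-- Two spins flipping at independent sparse random subsets of the same points are asymptotically
independent free spins. -/
theorem tendsto_integral_quenchedMean_mul {β lam : ℝ} (hβ : 0 < β) (hlam : 0 ≤ lam)
    {A B : SpinPath β → ℝ} (hA : Measurable A) (hB : Measurable B) {C D : ℝ}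
    (hC : ∀ σ, |A σ| ≤ C) (hD : ∀ σ, |B σ| ≤ D) :
    Tendsto (fun M : ℕ => ∫ y, quenchedMean (lam * β / M) A y * quenchedMean (lam * β / M) B y
        ∂(Measure.pi fun _ : Fin M => uniformTime β)) atTop
      (𝓝 ((∫ σ, A σ ∂(freeSpin β lam)) * ∫ σ, B σ ∂(freeSpin β lam))) := by
  have h1 := (tendsto_binomialFlipMean hβ hlam hA hC).mul (tendsto_binomialFlipMean hβ hlam hB hD)
  set r := lam * β with hr
  have hr0 : 0 ≤ r := by positivity
  have hC0 : 0 ≤ C := (abs_nonneg _).trans (hC (thinnedPath 1 ∅ (Fin.elim0 : Fin 0 → _)))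
  have hD0 : 0 ≤ D := (abs_nonneg _).trans (hD (thinnedPath 1 ∅ (Fin.elim0 : Fin 0 → _)))
  refine (tendsto_iff_of_dist ?_).2 h1
  have h2 : Tendsto (fun M : ℕ => 2 * (C * D) * (r ^ 2 / (M : ℝ))) atTop (𝓝 0) := by
    simpa using (tendsto_const_div_atTop_nhds_zero_nat (r ^ 2)).const_mul (2 * (C * D))
  refine tendsto_of_tendsto_of_tendsto_of_le_of_le' tendsto_const_nhds h2
    (Eventually.of_forall fun _ => dist_nonneg) ?_
  filter_upwards [eventually_gt_atTop 0, eventually_ge_atTop ⌈r⌉₊] with M hM hMr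
  have hM' : (0 : ℝ) < M := by exact_mod_cast hM
  have hp0 : 0 ≤ r / M := by positivity
  have hp1 : r / M ≤ 1 := by
    rw [div_le_one hM']; exact Nat.ceil_le.1 hMr
  rw [Real.dist_eq]
  refine (abs_integral_quenchedMean_mul_sub_le hβ hp0 hp1 hA hB hC hD).trans ?_
  refine mul_le_mul_of_nonneg_left ?_ (by positivity)
  -- Bernoulli's inequality bounds the collision probability by `M * (r / M) ^ 2 = r ^ 2 / M`.
  have h3 := one_add_mul_le_pow (a := -(r / M) ^ 2) (by nlinarith) M
  have h4 : (M : ℝ) * (r / M) ^ 2 = r ^ 2 / M := by field_simp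
  rw [sub_eq_add_neg 1 ((r / M) ^ 2)]
  linarith

theorem integrable_quenchedMean_mul {β : ℝ} (hβ : 0 < β) {M : ℕ} (p : ℝ) {A B : SpinPath β → ℝ}
    (hA : Measurable A) (hB : Measurable B) {C D : ℝ}
    (hC : ∀ σ, |A σ| ≤ C) (hD : ∀ σ, |B σ| ≤ D) :
    Integrable (fun y => quenchedMean p A y * quenchedMean p B y)
      (Measure.pi fun _ : Fin M => uniformTime β) := by
  have := isProbabilityMeasure_uniformTime hβ
  have hm : ∀ {A : SpinPath β → ℝ}, Measurable A →
      Measurable fun y : Fin M → TimeInterval β => quenchedMean p A y := fun hA =>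
    Finset.measurable_sum _ fun s _ => Finset.measurable_sum _ fun S _ =>
      ((hA.comp (measurable_thinnedPath s S)).const_mul _).const_mul _
  have hb : ∀ {A : SpinPath β → ℝ} {C : ℝ}, (∀ σ, |A σ| ≤ C) →
      ∃ K, ∀ y : Fin M → TimeInterval β, |quenchedMean p A y| ≤ K := fun {A C} hC => by
    refine ⟨∑ _s : ℤˣ, ∑ S : Finset (Fin M), 2⁻¹ * (|thinningWeight p S| * C), fun y => ?_⟩
    refine (Finset.abs_sum_le_sum_abs _ _).trans (Finset.sum_le_sum fun s _ => ?_)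
    refine (Finset.abs_sum_le_sum_abs _ _).trans (Finset.sum_le_sum fun S _ => ?_)
    rw [abs_mul, abs_mul, abs_of_pos (by norm_num : (0 : ℝ) < 2⁻¹)]
    gcongr
    exact hC _
  obtain ⟨K, hK⟩ := hb hC
  obtain ⟨L, hL⟩ := hb hD
  refine integrable_of_bounded ((hm hA).mul (hm hB)) (C := K * L) fun y => ?_
  rw [abs_mul]
  exact mul_le_mul (hK y) (hL y) (abs_nonneg _) ((abs_nonneg _).trans (hK y))

/-! ### From frozen points to the single-site measures -/

/-- The FKG inequality for the free spin weighted by a log-supermodular density. -/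
theorem freeSpin_fkg {β lam : ℝ} (hβ : 0 < β) (hlam : 0 ≤ lam) {w f g : SpinPath β → ℝ}
    (hwm : Measurable w) (hfm : Measurable f) (hgm : Measurable g)
    (hw0 : ∀ σ, 0 ≤ w σ) (hw : IsLogSupermodular w) {C D E : ℝ} (hwC : ∀ σ, w σ ≤ C)
    (hfD : ∀ σ, |f σ| ≤ D) (hgE : ∀ σ, |g σ| ≤ E)
    (hf : ∀ σ σ' : SpinPath β, (∀ t, σ.1 t ≤ σ'.1 t) → f σ ≤ f σ')
    (hg : ∀ σ σ' : SpinPath β, (∀ t, σ.1 t ≤ σ'.1 t) → g σ ≤ g σ') :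
    (∫ σ, w σ * f σ ∂(freeSpin β lam)) * (∫ σ, w σ * g σ ∂(freeSpin β lam)) ≤
      (∫ σ, w σ ∂(freeSpin β lam)) * ∫ σ, w σ * (f σ * g σ) ∂(freeSpin β lam) := by
  have hwb : ∀ σ, |w σ| ≤ C := fun σ => by rw [abs_of_nonneg (hw0 σ)]; exact hwC σ
  have hmul : ∀ {a b K L : ℝ}, |a| ≤ K → |b| ≤ L → |a * b| ≤ K * L := fun ha hb => by
    rw [abs_mul]; exact mul_le_mul ha hb (abs_nonneg _) ((abs_nonneg _).trans ha)
  have bf : ∀ σ, |w σ * f σ| ≤ C * D := fun σ => hmul (hwb σ) (hfD σ)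
  have bg : ∀ σ, |w σ * g σ| ≤ C * E := fun σ => hmul (hwb σ) (hgE σ)
  have bfg : ∀ σ, |w σ * (f σ * g σ)| ≤ C * (D * E) := fun σ =>
    hmul (hwb σ) (hmul (hfD σ) (hgE σ))
  refine le_of_tendsto_of_tendsto
    (tendsto_integral_quenchedMean_mul hβ hlam (hwm.mul hfm) (hwm.mul hgm) bf bg)
    (tendsto_integral_quenchedMean_mul hβ hlam hwm (hwm.mul (hfm.mul hgm)) hwb bfg) ?_
  -- The threshold `2 * (lam * β)` makes the thinning probability at most `1 / 2`.
  filter_upwards [eventually_gt_atTop 0, eventually_ge_atTop ⌈2 * (lam * β)⌉₊] with M hM hMr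
  have hM' : (0 : ℝ) < M := by exact_mod_cast hM
  have hp : lam * β / M ≤ 1 / 2 := by
    rw [div_le_iff₀ hM']; linarith [Nat.ceil_le.1 hMr]
  refine integral_mono
    (integrable_quenchedMean_mul hβ _ (hwm.mul hfm) (hwm.mul hgm) bf bg)
    (integrable_quenchedMean_mul hβ _ hwm (hwm.mul (hfm.mul hgm)) hwb bfg) fun y => ?_
  exact quenchedMean_fkg (by positivity) hp hw0 hw (fun σ => (abs_le.1 (hfD σ)).1)
    (fun σ => (abs_le.1 (hgE σ)).1) hf hg y

/-- The constant spin. -/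
noncomputable def constSpin (β : ℝ) (s : ℤˣ) : SpinPath β := flipPath s ⟨0, Fin.elim0⟩

theorem constSpin_apply (β : ℝ) (s : ℤˣ) (t : TimeInterval β) :
    (constSpin β s).1 t = ((s : ℤ) : ℝ) := by
  simp [constSpin, flipPath, pointCount]

/-- Every spin lies between the constant spins `-1` and `1`, so monotonicity alone bounds `f`. -/
theorem SpinIncreasing.exists_abs_le {β : ℝ} {f : SpinPath β → ℝ} (hf : SpinIncreasing f) :
    ∃ D, ∀ σ, |f σ| ≤ D := by
  refine ⟨max |f (constSpin β (-1))| |f (constSpin β 1)|, fun σ => abs_le_max_abs_abs ?_ ?_⟩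
  · refine hf _ _ (Eventually.of_forall fun t => ?_)
    rw [constSpin_apply]
    rcases σ.2.values t with h | h <;> rw [h] <;> norm_num
  · refine hf _ _ (Eventually.of_forall fun t => ?_)
    rw [constSpin_apply]
    rcases σ.2.values t with h | h <;> rw [h] <;> norm_num

theorem integral_tilted_eq_div {α : Type*} [MeasurableSpace α] (μ : Measure α) (u F : α → ℝ) :
    ∫ x, F x ∂(μ.tilted u) = (∫ x, Real.exp (u x) * F x ∂μ) / ∫ x, Real.exp (u x) ∂μ := by
  rw [integral_tilted, ← integral_div]
  exact integral_congr_ae (Eventually.of_forall fun x => by simp only [smul_eq_mul]; ring)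

/-- Division by zero being zero, `z = 0` is covered, so positivity of the normalizing constants is
not required. -/
theorem mul_div_le_div_of_mul_le {a b c z : ℝ} (hz : 0 ≤ z) (h : a * b ≤ z * c) :
    a / z * (b / z) ≤ c / z := by
  rcases hz.eq_or_lt with rfl | hz
  · simp
  · rw [div_mul_div_comm, div_le_div_iff₀ (by positivity) hz]
    nlinarith

theorem corollary3p3 {β lam : ℝ} (hβ : 0 < β) (hlam : 0 ≤ lam)
    (h : TimeInterval β → ℝ) (hh : MemLp h ⊤ (timeMeasure β)) (π : TimeBC)
    (f g : SpinPath β → ℝ) (hf : SpinIncreasing f) (hg : SpinIncreasing g)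
    (hfm : Measurable f) (hgm : Measurable g) :
    (∫ σ, f σ * g σ ∂(spinMeasure hβ h lam π)) ≥
      (∫ σ, f σ ∂(spinMeasure hβ h lam π)) * (∫ σ, g σ ∂(spinMeasure hβ h lam π)) := by
  obtain ⟨C, hC⟩ := exists_fieldDot_le hβ hh
  obtain ⟨D, hD⟩ := hf.exists_abs_le
  obtain ⟨E, hE⟩ := hg.exists_abs_le
  have hf' : ∀ σ σ' : SpinPath β, (∀ t, σ.1 t ≤ σ'.1 t) → f σ ≤ f σ' := fun σ σ' hσ =>
    hf σ σ' (Eventually.of_forall hσ)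
  have hg' : ∀ σ σ' : SpinPath β, (∀ t, σ.1 t ≤ σ'.1 t) → g σ ≤ g σ' := fun σ σ' hσ =>
    hg σ σ' (Eventually.of_forall hσ)
  have hwm : Measurable fun σ : SpinPath β => Real.exp (fieldDot h σ) :=
    Real.measurable_exp.comp (measurable_fieldDot hβ hh.aestronglyMeasurable)
  have hw := isLogSupermodular_exp_fieldDot hβ hh
  have hw0 : ∀ σ : SpinPath β, 0 ≤ Real.exp (fieldDot h σ) := fun σ => (Real.exp_pos _).le
  have hwC : ∀ σ : SpinPath β, Real.exp (fieldDot h σ) ≤ Real.exp C := fun σ =>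
    Real.exp_le_exp.2 (hC σ)
  cases π with
  | free =>
    simp only [spinMeasure, integral_tilted_eq_div]
    exact mul_div_le_div_of_mul_le (integral_nonneg hw0)
      (freeSpin_fkg hβ hlam hwm hfm hgm hw0 hw hwC hD hE hf' hg')
  | periodic =>
    simp only [spinMeasure, integral_tilted_eq_div]
    refine mul_div_le_div_of_mul_le (integral_nonneg hw0) ?_
    have hP := measurableSet_periodicEvent hβ
    have key := freeSpin_fkg hβ hlam (hwm.indicator hP) hfm hgm
      (fun σ => indicator_nonneg (fun σ _ => hw0 σ) σ) (hw.indicator_periodicEvent hβ hw0)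
      (fun σ => (indicator_le_self' (fun σ _ => hw0 σ) σ).trans (hwC σ)) hD hE hf' hg'
    -- Moving the indicator outside the product turns each weighted integral into one over the
    -- periodic event.
    have e : ∀ (F : SpinPath β → ℝ) (σ : SpinPath β),
        (periodicEvent hβ).indicator (fun σ => Real.exp (fieldDot h σ)) σ * F σ =
          (periodicEvent hβ).indicator (fun σ => Real.exp (fieldDot h σ) * F σ) σ := fun F σ =>
      (indicator_mul_left _ _ _).symm
    simpa only [e f, e g, e fun σ => f σ * g σ, integral_indicator hP] using key
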